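/- Write $\mathcal M_d$ for the algebra of complex $d\times d$ matrices with the operator norm $\|\cdot\|_{\mathrm{op}}$ induced by the Euclidean norm of $\mathbb C^d$, and give $\mathcal M_d\oplus\mathcal M_e$ the norm $\|(A,B)\|_{\mathrm{op}}=\max\{\|A\|_{\mathrm{op}},\|B\|_{\mathrm{op}}\}$. For an irrational $\theta\in(0,1)$ let $(r_n^\theta)_{n\ge 0}$, with $r_0^\theta=0$ and $r_n^\theta\ge 1$ for $n\ge1$, be its continued fraction expansion, and let $p_n^\theta,q_n^\theta$ be given by $p_{-1}^\theta=1$, $p_0^\theta=r_0^\theta=0$, $q_{-1}^\theta=0$, $q_0^\theta=1$, and, for $n\ge0$, $p_{n+1}^\theta=r_{n+1}^\theta p_n^\theta+p_{n-1}^\theta$, $q_{n+1}^\theta=r_{n+1}^\theta q_n^\theta+q_{n-1}^\theta$. Put $\mathcal A_{\theta,n}=\mathcal M_{q_n^\theta}\oplus\mathcal M_{q_{n-1}^\theta}$ for $n\ge 0$ (so $\mathcal A_{\theta,0}=\mathbb C$). For $n\ge0$ let $\alpha_{\theta,n}:\mathcal A_{\theta,n}\to\mathcal A_{\theta,n+1}$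 be the unital $*$-homomorphism $A\oplus B\mapsto\mathrm{diag}(A,\dots,A,B)\oplus A$ with $r_{n+1}^\theta$ copies of $A$ on the diagonal, and put $\mathcal B_{\theta,n+1}=\alpha_{\theta,n}(\mathcal A_{\theta,n})$, a unital C*-subalgebra of $\mathcal A_{\theta,n+1}$. For $N\ge1$ let $t(\theta,N)=(-1)^{N-1}q_N^\theta(\theta q_{N-1}^\theta-p_{N-1}^\theta)\in(0,1)$ and let $\tau_{\theta,N}$ be the faithful tracial state $$\tau_{\theta,N}(A,B)=\frac{t(\theta,N)}{q_N^\theta}\mathrm{Tr}(A)+\frac{1-t(\theta,N)}{q_{N-1}^\theta}\mathrm{Tr}(B)$$ on $\mathcal A_{\theta,N}$. A $\tau_{\theta,N}$-preserving conditional expectation onto $\mathcal B_{\theta,N}$ is a linear map $P:\mathcal A_{\theta,N}\to\mathcal B_{\theta,N}$ with $P(b)=b$ for $b\in\mathcal B_{\theta,N}$, $\|P(a)\|_{\mathrm{op}}\le\|a\|_{\mathrm{op}}$ and $\tau_{\theta,N}(P(a))=\tau_{\theta,N}(a)$ for $a\in\mathcal A_{\theta,N}$. **Theorem.** Let $N\ge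 1$ be an integer, and for irrational $\theta\in(0,1)$ put $$\kappa_N(\theta)=\frac{\theta q_N^\theta-p_N^\theta}{(\theta q_{N-2}^\theta-p_{N-2}^\theta)\,r_N^\theta\,(r_N^\theta+1)^2}.$$ (1) For every irrational $\theta\in(0,1)$ we have $\kappa_N(\theta)>0$, there is exactly one $\tau_{\theta,N}$-preserving conditional expectation $P$ onto $\mathcal B_{\theta,N}$, and the Frobenius–Rieffel norm $\|a\|_{\theta,N}=\sqrt{\|P(a^*a)\|_{\mathrm{op}}}$ satisfies $$\sqrt{\kappa_N(\theta)}\;\|a\|_{\mathrm{op}}\le\|a\|_{\theta,N}\le\|a\|_{\mathrm{op}}\qquad\text{for all }a\in\mathcal A_{\theta,N}.$$ (2) If $(\theta_n)_{n}$ is a sequence of irrationals in $(0,1)$ converging to an irrational $\theta\in(0,1)$, then $\lim_{n\to\infty}\kappa_N(\theta_n)=\kappa_N(\theta)$; in particular $\theta\mapsto\sqrt{\kappa_N(\theta)}$ is continuous on the irrationals of $(0,1)$. -/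

import Mathlib

open Filter Topology Set
open scoped Kronecker Matrix.Norms.L2Operator

namespace EffrosShen

/-! ### Conditional expectations and Frobenius–Rieffel norms -/

section General

variable {A : Type*} [CStarAlgebra A]

/-- `P : A → B` is a `φ`-preserving conditional expectation onto the unital *-subalgebra `B`:
a linear contraction that fixes `B` pointwise and satisfies `φ ∘ P = φ`. (It is only used for a
finite-dimensional `A`, where every unital *-subalgebra is a unital C*-subalgebra.) -/
structure IsPreservingCondExp (φ : A →ₗ[ℂ] ℂ) (B : StarSubalgebra ℂ A) (P : A →ₗ[ℂ] B) :
    Prop where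
  apply_coe : ∀ b : B, P (b : A) = b
  norm_le : ∀ a : A, ‖(P a : A)‖ ≤ ‖a‖
  preserving : ∀ a : A, φ (P a : A) = φ a

/-- The Frobenius–Rieffel norm `‖a‖_P = √‖P (a* a)‖` of a conditional expectation `P` onto `B`. -/
noncomputable def frobeniusRieffelNorm {B : StarSubalgebra ℂ A} (P : A →ₗ[ℂ] B) (a : A) : ℝ :=
  Real.sqrt ‖(P (star a * a) : A)‖

end General

/-! ### Matrix algebras -/

/-- `𝓜_a ⊕ 𝓜_b`: its norm is the maximum of the operator norms (with respect to the Euclidean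
norms) of the two summands. -/
abbrev TwoBlock (a b : ℕ) : Type :=
  Matrix (Fin a) (Fin a) ℂ × Matrix (Fin b) (Fin b) ℂ

/-- `Fin (r * a + b)` as `r` consecutive intervals of length `a`, followed by one of length `b`. -/
def blockEquiv (r a b : ℕ) : (Fin r × Fin a) ⊕ Fin b ≃ Fin (r * a + b) :=
  (Equiv.sumCongr finProdFinEquiv (Equiv.refl (Fin b))).trans finSumFinEquiv

/-- The block diagonal matrix `diag(X, …, X, Y)` with `r` copies of `X`. -/
def diagRepeat (r a b : ℕ) (X : Matrix (Fin a) (Fin a) ℂ) (Y : Matrix (Fin b) (Fin b) ℂ) :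
    Matrix (Fin (r * a + b)) (Fin (r * a + b)) ℂ :=
  Matrix.reindex (blockEquiv r a b) (blockEquiv r a b)
    (Matrix.fromBlocks ((1 : Matrix (Fin r) (Fin r) ℂ) ⊗ₖ X) 0 0 Y)

/-- The unital *-homomorphism `X ⊕ Y ↦ diag(X, …, X, Y) ⊕ X`, with `r` copies of `X`. -/
def diagHom (r a b : ℕ) : TwoBlock a b →⋆ₐ[ℂ] TwoBlock (r * a + b) a where
  toFun x := (diagRepeat r a b x.1 x.2, x.1)
  map_one' := by
    simp [diagRepeat]
  map_mul' x y := by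
    ext1
    · simp only [diagRepeat, Prod.fst_mul, Prod.snd_mul, Matrix.reindex_apply,
        Matrix.submatrix_mul_equiv, Matrix.fromBlocks_multiply, ← Matrix.mul_kronecker_mul]
      simp
    · rfl
  map_zero' := by
    simp [diagRepeat]
  map_add' x y := by
    ext1
    · simp only [diagRepeat, Prod.fst_add, Prod.snd_add, Matrix.reindex_apply,
        Matrix.kronecker_add]
      ext i j
      rw [Matrix.add_apply]
      simp only [Matrix.submatrix_apply]
      rw [← Matrix.add_apply, Matrix.fromBlocks_add]
      simp
    · rfl
  commutes' c := by
    ext1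
    · have h : Matrix.fromBlocks (c • (1 : Matrix (Fin r × Fin a) (Fin r × Fin a) ℂ)) 0 0
          (c • (1 : Matrix (Fin b) (Fin b) ℂ)) = c • 1 := by
        rw [← Matrix.fromBlocks_one, Matrix.fromBlocks_smul]
        simp
      simp [diagRepeat, Algebra.algebraMap_eq_smul_one, Matrix.kronecker_smul, h]
      ext i j
      simp [Matrix.one_apply]
    · rfl
  map_star' x := by
    ext1
    · simp [diagRepeat, Matrix.star_eq_conjTranspose, Matrix.conjTranspose_submatrix,
        Matrix.fromBlocks_conjTranspose, Matrix.conjTranspose_kronecker]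
    · rfl

/-- The tracial functional `τ_v (X ⊕ Y) = (t / a) Tr X + ((1 - t) / b) Tr Y`, `v = (t, 1 - t)`. -/
noncomputable def traceFunctional (a b : ℕ) (t : ℝ) : TwoBlock a b →ₗ[ℂ] ℂ :=
  ((t : ℂ) / (a : ℂ)) • (Matrix.traceLinearMap (Fin a) ℂ ℂ ∘ₗ LinearMap.fst ℂ _ _) +
    ((1 - (t : ℂ)) / (b : ℂ)) • (Matrix.traceLinearMap (Fin b) ℂ ℂ ∘ₗ LinearMap.snd ℂ _ _)

/-! ### Continued fractions -/

/-- The `n`-th term `r_n` (`n = 0, 1, 2, …`) of the continued fraction expansion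
`θ = r_0 + 1 / (r_1 + 1 / (r_2 + ⋯))` of a positive real number `θ`
(the default value `0` does not occur for an irrational `θ`). -/
noncomputable def cfTerm (θ : ℝ) (n : ℕ) : ℕ :=
  match GenContFract.IntFractPair.stream θ n with
  | some x => x.b.toNat
  | none => 0

/-- Numerators of the convergents, with the index shifted by one: `cfNum θ k = p_{k-1}`, so
`p_{-1} = 1`, `p_0 = r_0` and `p_{k+1} = r_{k+1} p_k + p_{k-1}`. -/
noncomputable def cfNum (θ : ℝ) : ℕ → ℕ
  | 0 => 1
  | 1 => cfTerm θ 0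
  | k + 2 => cfTerm θ (k + 1) * cfNum θ (k + 1) + cfNum θ k

/-- Denominators of the convergents, with the index shifted by one: `cfDen θ k = q_{k-1}`, so
`q_{-1} = 0`, `q_0 = 1` and `q_{k+1} = r_{k+1} q_k + q_{k-1}`. -/
noncomputable def cfDen (θ : ℝ) : ℕ → ℕ
  | 0 => 0
  | 1 => 1
  | k + 2 => cfTerm θ (k + 1) * cfDen θ (k + 1) + cfDen θ k

/-! ### The Effros–Shen building blocks -/

/-- `𝓐_{θ,n} = 𝓜_{q_n} ⊕ 𝓜_{q_{n-1}}`. For `n = 0` this is `𝓜_1 ⊕ 𝓜_0 = ℂ`, as `q_{-1} = 0`. -/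
abbrev Alg (θ : ℝ) (n : ℕ) : Type :=
  TwoBlock (cfDen θ (n + 1)) (cfDen θ n)

/-- `α_{θ,n} : 𝓐_{θ,n} → 𝓐_{θ,n+1}`, `X ⊕ Y ↦ diag(X, …, X, Y) ⊕ X` with `r_{n+1}` copies of `X`. -/
noncomputable def embed (θ : ℝ) (n : ℕ) : Alg θ n →⋆ₐ[ℂ] Alg θ (n + 1) :=
  diagHom (cfTerm θ (n + 1)) (cfDen θ (n + 1)) (cfDen θ n)

/-- The unital C*-subalgebra `𝓑_{θ,n+1} = α_{θ,n}(𝓐_{θ,n})` of `𝓐_{θ,n+1}`. -/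
noncomputable def Sub (θ : ℝ) (n : ℕ) : StarSubalgebra ℂ (Alg θ (n + 1)) :=
  (embed θ n).range

/-- The weight `t(θ, N) = (-1)^(N-1) q_N (θ q_{N-1} - p_{N-1})` for `N = n + 1`. -/
noncomputable def weight (θ : ℝ) (n : ℕ) : ℝ :=
  (-1) ^ n * (cfDen θ (n + 2) : ℝ) * (θ * (cfDen θ (n + 1) : ℝ) - (cfNum θ (n + 1) : ℝ))

/-- The tracial state `τ_{v(θ,N)}` on `𝓐_{θ,N}`, `v(θ,N) = (t(θ,N), 1 - t(θ,N))`, `N = n + 1`. -/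
noncomputable def traceState (θ : ℝ) (n : ℕ) : Alg θ (n + 1) →ₗ[ℂ] ℂ :=
  traceFunctional (cfDen θ (n + 2)) (cfDen θ (n + 1)) (weight θ n)

/-- The quotient `(θ q_N - p_N) / ((θ q_{N-2} - p_{N-2}) r_N (r_N + 1)²)` for `N = n + 1`. -/
noncomputable def ratio (θ : ℝ) (n : ℕ) : ℝ :=
  (θ * (cfDen θ (n + 2) : ℝ) - (cfNum θ (n + 2) : ℝ)) /
    ((θ * (cfDen θ n : ℝ) - (cfNum θ n : ℝ)) * (cfTerm θ (n + 1) : ℝ) *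
      ((cfTerm θ (n + 1) : ℝ) + 1) ^ 2)

/-- The irrational numbers of the interval `(0, 1)`. -/
def irrationals : Set ℝ := {θ | 0 < θ ∧ θ < 1 ∧ Irrational θ}

end EffrosShen

/-!
Write `δ_k = |θ q_k - p_k|`. Since `δ_{N-2} = r_N δ_{N-1} + δ_N` and
`q_N δ_{N-1} + q_{N-1} δ_N = 1`, the tracial state on `𝓐_{θ,N}` is `δ_{N-1} Tr ⊕ δ_N Tr`
(`traceState_apply`), with `0 < δ_N ≤ δ_{N-1}`, and
`κ_N(θ) = δ_N / (δ_{N-2} r_N (r_N + 1)²)` (`ratio_eq`). The rest of the first part holds for every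
trace `w Tr ⊕ s Tr` with `0 < s ≤ w` (`existsUnique_condExp_and_norm_le`).

*Existence.* The map that sends `C ⊕ D` to the image of `X ⊕ Y`, where `Y` is the last diagonal block
of `C` and `X` the weighted average of the other `r` diagonal blocks of `C` and of `D`, is a
trace-preserving conditional expectation (`isPreservingCondExp_blockCondExp`).

*Uniqueness.* By Tomiyama's argument a contractive projection onto `B` commutes with left
multiplication by projections of `B` (`IsPreservingCondExp.apply_isStarProjection_mul`). Matrix
algebras are spanned by their projections, so it is a left `B`-module map, and the faithful trace
then determines it (`IsPreservingCondExp.unique_of_span`).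

*Norms.* The upper bound is contractivity. For the lower bound, apply the explicit expectation to
`(C ⊕ D)* (C ⊕ D)`. Each of the positive matrices averaged in `X` is bounded by a multiple of `X`, so
`‖D‖²` and the squared norms of the columns of blocks of `C` are at most `(r w + s) / s` times the
norm of the expectation; `C` is the sum of its `r + 1` columns of blocks
(`norm_sq_le_blockCondExp`).

*Continuity.* The complete quotients of an irrational number are never integers, hence they depend
continuously on it, and the `r_k`, `p_k`, `q_k` are locally constant on the irrationals. So near `θ`
the function `κ_N` is a rational function of its argument (`continuousOn_ratio`).
-/

namespace EffrosShen

/-! ### Continued fractions of irrational numbers -/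

/-- The complete quotients of `θ`: `ξ_0 = θ` and `ξ_{n+1} = 1 / (ξ_n - ⌊ξ_n⌋)`. -/
noncomputable def completeQuotient (θ : ℝ) : ℕ → ℝ
  | 0 => θ
  | n + 1 => (Int.fract (completeQuotient θ n))⁻¹

theorem irrational_fract {x : ℝ} (hx : Irrational x) : Irrational (Int.fract x) := by
  rw [← Int.self_sub_floor]
  exact hx.sub_intCast _

theorem fract_pos_of_irrational {x : ℝ} (hx : Irrational x) : 0 < Int.fract x :=
  (Int.fract_nonneg x).lt_of_ne (irrational_fract hx).ne_zero.symm

theorem irrational_completeQuotient {θ : ℝ} (hθ : Irrational θ) :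
    ∀ n, Irrational (completeQuotient θ n)
  | 0 => hθ
  | n + 1 => irrational_inv_iff.mpr (irrational_fract (irrational_completeQuotient hθ n))

theorem one_lt_completeQuotient_succ {θ : ℝ} (hθ : Irrational θ) (n : ℕ) :
    1 < completeQuotient θ (n + 1) :=
  (one_lt_inv₀ (fract_pos_of_irrational (irrational_completeQuotient hθ n))).mpr
    (Int.fract_lt_one _)

theorem stream_eq_of_irrational {θ : ℝ} (hθ : Irrational θ) (n : ℕ) :
    GenContFract.IntFractPair.stream θ n =
      some (GenContFract.IntFractPair.of (completeQuotient θ n)) := by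
  induction n with
  | zero => rfl
  | succ n ih =>
    exact GenContFract.IntFractPair.stream_succ_of_some ih
      (fract_pos_of_irrational (irrational_completeQuotient hθ n)).ne'

theorem cfTerm_eq_toNat_floor {θ : ℝ} (hθ : Irrational θ) (n : ℕ) :
    cfTerm θ n = ⌊completeQuotient θ n⌋.toNat := by
  simp only [cfTerm, stream_eq_of_irrational hθ n]
  rfl

theorem cast_cfTerm_succ {θ : ℝ} (hθ : Irrational θ) (n : ℕ) :
    (cfTerm θ (n + 1) : ℝ) = ⌊completeQuotient θ (n + 1)⌋ := by
  have h : 0 ≤ ⌊completeQuotient θ (n + 1)⌋ :=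
    Int.floor_nonneg.mpr (zero_le_one.trans (one_lt_completeQuotient_succ hθ n).le)
  rw [cfTerm_eq_toNat_floor hθ]
  exact_mod_cast Int.toNat_of_nonneg h

theorem one_le_cfTerm_succ {θ : ℝ} (hθ : Irrational θ) (n : ℕ) : 1 ≤ cfTerm θ (n + 1) := by
  have h : (1 : ℤ) ≤ ⌊completeQuotient θ (n + 1)⌋ :=
    Int.le_floor.mpr (by exact_mod_cast (one_lt_completeQuotient_succ hθ n).le)
  rw [cfTerm_eq_toNat_floor hθ]
  omega

theorem cfDen_succ_pos {θ : ℝ} (hθ : Irrational θ) : ∀ n, 0 < cfDen θ (n + 1)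
  | 0 => Nat.one_pos
  | n + 1 => Nat.add_pos_left (Nat.mul_pos (one_le_cfTerm_succ hθ n) (cfDen_succ_pos hθ n)) _

/-- The distance `|θ q_{k-1} - p_{k-1}|`, written with the sign `(-1) ^ (k + 1)` that
`θ q_{k-1} - p_{k-1}` has. -/
noncomputable def approxError (θ : ℝ) (k : ℕ) : ℝ :=
  (-1) ^ (k + 1) * (θ * cfDen θ k - cfNum θ k)

theorem approxError_zero (θ : ℝ) : approxError θ 0 = 1 := by
  simp [approxError, cfDen, cfNum]

theorem approxError_add_two (θ : ℝ) (k : ℕ) :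
    approxError θ (k + 2) = approxError θ k - cfTerm θ (k + 1) * approxError θ (k + 1) := by
  simp only [approxError, cfDen, cfNum]
  push_cast
  ring

theorem approxError_succ {θ : ℝ} (h0 : 0 < θ) (hθ : Irrational θ) (k : ℕ) :
    approxError θ (k + 1) = Int.fract (completeQuotient θ k) * approxError θ k := by
  induction k with
  | zero =>
    have h : (cfTerm θ 0 : ℝ) = ⌊θ⌋ := by
      rw [cfTerm_eq_toNat_floor hθ]
      exact_mod_cast Int.toNat_of_nonneg (Int.floor_nonneg.mpr h0.le)
    simp [approxError, cfDen, cfNum, h, completeQuotient]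
  | succ k ih =>
    have hf := (fract_pos_of_irrational (irrational_completeQuotient hθ k)).ne'
    have h : approxError θ k = completeQuotient θ (k + 1) * approxError θ (k + 1) := by
      rw [ih, completeQuotient, inv_mul_cancel_left₀ hf]
    rw [approxError_add_two, cast_cfTerm_succ hθ, ← Int.self_sub_floor, sub_mul, ← h]

theorem approxError_pos {θ : ℝ} (h0 : 0 < θ) (hθ : Irrational θ) (k : ℕ) :
    0 < approxError θ k := by
  induction k with
  | zero => simp [approxError_zero]
  | succ k ih =>
    rw [approxError_succ h0 hθ]
    exact mul_pos (fract_pos_of_irrational (irrational_completeQuotient hθ k)) ih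

theorem approxError_succ_le {θ : ℝ} (h0 : 0 < θ) (hθ : Irrational θ) (k : ℕ) :
    approxError θ (k + 1) ≤ approxError θ k := by
  rw [approxError_succ h0 hθ]
  exact mul_le_of_le_one_left (approxError_pos h0 hθ k).le (Int.fract_lt_one _).le

/-- The identity `q_k |θ q_{k-1} - p_{k-1}| + q_{k-1} |θ q_k - p_k| = 1`. -/
theorem cfDen_mul_approxError_add (θ : ℝ) (k : ℕ) :
    cfDen θ (k + 1) * approxError θ k + cfDen θ k * approxError θ (k + 1) = 1 := by
  induction k with
  | zero => simp [approxError_zero, cfDen]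
  | succ k ih =>
    rw [approxError_add_two, ← ih, show cfDen θ (k + 1 + 1) =
      cfTerm θ (k + 1) * cfDen θ (k + 1) + cfDen θ k from rfl]
    push_cast
    ring

theorem weight_eq (θ : ℝ) (n : ℕ) : weight θ n = cfDen θ (n + 2) * approxError θ (n + 1) := by
  simp only [weight, approxError]
  ring

theorem ratio_eq (θ : ℝ) (n : ℕ) :
    ratio θ n = approxError θ (n + 2) /
      (approxError θ n * cfTerm θ (n + 1) * ((cfTerm θ (n + 1) : ℝ) + 1) ^ 2) := by
  have hs : ((-1 : ℝ) ^ (n + 1)) ≠ 0 := pow_ne_zero _ (by norm_num)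
  simp only [ratio, approxError]
  rw [show ((-1 : ℝ) ^ (n + 2 + 1)) = (-1) ^ (n + 1) by ring, mul_assoc _ _ (cfTerm θ (n + 1) : ℝ),
    mul_assoc _ (_ * _) (_ ^ 2), mul_div_mul_left _ _ hs, mul_assoc _ (cfTerm θ (n + 1) : ℝ)]

theorem ratio_pos {θ : ℝ} (h0 : 0 < θ) (hθ : Irrational θ) (n : ℕ) : 0 < ratio θ n := by
  rw [ratio_eq]
  have h := approxError_pos h0 hθ
  have hr : (0 : ℝ) < cfTerm θ (n + 1) := by exact_mod_cast one_le_cfTerm_succ hθ n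
  have h1 := h n
  have h2 := h (n + 2)
  positivity

/-! ### Continuity in the irrational parameter -/

theorem eventually_floor_eq {x : ℝ} (hx : Irrational x) : ∀ᶠ y in 𝓝 x, ⌊y⌋ = ⌊x⌋ := by
  have h1 : (⌊x⌋ : ℝ) < x := (Int.floor_le x).lt_of_ne (hx.ne_int _).symm
  filter_upwards [Ioo_mem_nhds h1 (Int.lt_floor_add_one x)] with y hy
  exact Int.floor_eq_iff.mpr ⟨hy.1.le, hy.2⟩

theorem continuousAt_completeQuotient {θ : ℝ} (hθ : Irrational θ) (n : ℕ) :
    ContinuousAt (fun x => completeQuotient x n) θ := by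
  induction n with
  | zero => exact continuousAt_id
  | succ n ih =>
    have hξ := irrational_completeQuotient hθ n
    have hf : ContinuousAt (fun x => Int.fract (completeQuotient x n)) θ := by
      have h : ContinuousAt (fun x => completeQuotient x n - ⌊completeQuotient θ n⌋) θ :=
        ih.sub continuousAt_const
      refine h.congr ?_
      filter_upwards [ih.eventually (eventually_floor_eq hξ)] with x hx
      rw [← hx, Int.self_sub_floor]
    exact hf.inv₀ (fract_pos_of_irrational hξ).ne'

/-- The terms of the continued fraction expansion are locally constant on the irrationals. -/
theorem eventually_cfTerm_eq {θ : ℝ} (hθ : θ ∈ irrationals) (n : ℕ) :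
    ∀ᶠ x in 𝓝[irrationals] θ, cfTerm x n = cfTerm θ n := by
  have h : ∀ᶠ x in 𝓝[irrationals] θ, ⌊completeQuotient x n⌋ = ⌊completeQuotient θ n⌋ :=
    nhdsWithin_le_nhds ((continuousAt_completeQuotient hθ.2.2 n).eventually
      (eventually_floor_eq (irrational_completeQuotient hθ.2.2 n)))
  filter_upwards [h, self_mem_nhdsWithin] with x hx hmem
  rw [cfTerm_eq_toNat_floor hmem.2.2, cfTerm_eq_toNat_floor hθ.2.2, hx]

theorem eventually_cfDen_cfNum_eq {θ : ℝ} (hθ : θ ∈ irrationals) (n : ℕ) :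
    ∀ᶠ x in 𝓝[irrationals] θ,
      (cfDen x n = cfDen θ n ∧ cfNum x n = cfNum θ n) ∧
        cfDen x (n + 1) = cfDen θ (n + 1) ∧ cfNum x (n + 1) = cfNum θ (n + 1) := by
  induction n with
  | zero =>
    filter_upwards [eventually_cfTerm_eq hθ 0] with x hx
    exact ⟨⟨rfl, rfl⟩, rfl, hx⟩
  | succ n ih =>
    filter_upwards [ih, eventually_cfTerm_eq hθ (n + 1)] with x ⟨⟨h1, h2⟩, h3, h4⟩ hx
    refine ⟨⟨h3, h4⟩, ?_, ?_⟩
    · simp only [cfDen, hx, h1, h3]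
    · simp only [cfNum, hx, h2, h4]

theorem continuousOn_ratio (n : ℕ) : ContinuousOn (fun θ => ratio θ n) irrationals := by
  intro θ hθ
  have hr : (0 : ℝ) < cfTerm θ (n + 1) := by exact_mod_cast one_le_cfTerm_succ hθ.2.2 n
  have hd : θ * (cfDen θ n : ℝ) - cfNum θ n ≠ 0 := by
    intro h
    have := approxError_pos hθ.1 hθ.2.2 n
    simp [approxError, h] at this
  have hc : ContinuousAt (fun x : ℝ => (x * (cfDen θ (n + 2) : ℝ) - (cfNum θ (n + 2) : ℝ)) /
      ((x * (cfDen θ n : ℝ) - (cfNum θ n : ℝ)) * (cfTerm θ (n + 1) : ℝ) *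
        ((cfTerm θ (n + 1) : ℝ) + 1) ^ 2)) θ :=
    ContinuousAt.div (by fun_prop) (by fun_prop)
      (mul_ne_zero (mul_ne_zero hd hr.ne') (by positivity))
  refine hc.continuousWithinAt.congr_of_eventuallyEq ?_ rfl
  filter_upwards [eventually_cfDen_cfNum_eq hθ n, eventually_cfDen_cfNum_eq hθ (n + 1),
    eventually_cfTerm_eq hθ (n + 1)] with x ⟨⟨h1, h2⟩, _⟩ ⟨_, h3, h4⟩ hx
  rw [ratio, h1, h2, h3, h4, hx]

/-! ### Conditional expectations on C*-algebras -/

section Tomiyama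

variable {A : Type*} [CStarAlgebra A]

/-- The two summands have orthogonal ranges, so the C*-identity gives a Pythagorean estimate. -/
theorem norm_sq_le_of_star_mul_eq_zero {x y : A} (h : star x * y = 0) :
    ‖x + y‖ ^ 2 ≤ ‖x‖ ^ 2 + ‖y‖ ^ 2 := by
  have h' : star y * x = 0 := by simpa using congrArg star h
  rw [sq, sq, sq, ← CStarRing.norm_star_mul_self, ← CStarRing.norm_star_mul_self (x := x),
    ← CStarRing.norm_star_mul_self (x := y)]
  have : star (x + y) * (x + y) = star x * x + star y * y := by
    rw [star_add, add_mul, mul_add, mul_add, h, h']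
    abel
  rw [this]
  exact norm_add_le _ _

namespace IsPreservingCondExp

variable {φ : A →ₗ[ℂ] ℂ} {B : StarSubalgebra ℂ A} {P : A →ₗ[ℂ] B}

/-- One half of Tomiyama's argument: `P` maps `e A` into `e A`. With `y = (1 - e) P(e x)`, the
element `e x + c y` has norm at most `√(‖e x‖² + c² ‖y‖²)`, while the compression by `1 - e` of its
image is `(1 + c) y`; for large real `c` this forces `y = 0`. -/
theorem one_sub_mul_apply_eq_zero (hP : IsPreservingCondExp φ B P) {e : A}
    (he : IsStarProjection e) (heB : e ∈ B) (x : A) : (1 - e) * (P (e * x) : A) = 0 := by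
  set y : A := (1 - e) * (P (e * x) : A) with hy
  have hyB : y ∈ B := B.mul_mem (B.sub_mem B.one_mem heB) (P (e * x)).2
  have hee : e * e = e := he.isIdempotentElem
  have hes : star e = e := he.isSelfAdjoint
  have hee' : (1 - e) * (1 - e) = 1 - e := by
    rw [mul_sub, sub_mul, sub_mul, hee]
    simp
  have hn : ‖(1 - e : A)‖ ≤ 1 := he.one_sub.norm_le
  have key : ∀ c : ℝ, (1 + c) ^ 2 * ‖y‖ ^ 2 ≤ ‖e * x‖ ^ 2 + c ^ 2 * ‖y‖ ^ 2 := by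
    intro c
    have hPy : (P ((c : ℂ) • y) : A) = (c : ℂ) • y := by
      rw [map_smul]
      have := congrArg Subtype.val (hP.apply_coe ⟨y, hyB⟩)
      simpa using congrArg ((c : ℂ) • ·) this
    have h1 : (1 - e) * (P (e * x + (c : ℂ) • y) : A) = ((1 + c : ℝ) : ℂ) • y := by
      rw [map_add, AddMemClass.coe_add, hPy, mul_add, ← hy, mul_smul_comm, hy, ← mul_assoc, hee']
      push_cast
      rw [add_smul, one_smul]
    have h2 : ‖((1 + c : ℝ) : ℂ) • y‖ ≤ ‖e * x + (c : ℂ) • y‖ := by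
      rw [← h1]
      calc _ ≤ ‖(1 - e : A)‖ * ‖(P (e * x + (c : ℂ) • y) : A)‖ := norm_mul_le _ _
        _ ≤ 1 * ‖e * x + (c : ℂ) • y‖ :=
          mul_le_mul hn (hP.norm_le _) (norm_nonneg _) zero_le_one
        _ = _ := one_mul _
    have h3 : star (e * x) * ((c : ℂ) • y) = 0 := by
      rw [mul_smul_comm, hy, star_mul, hes, mul_assoc, ← mul_assoc e, mul_sub, hee]
      simp
    have h4 := (pow_le_pow_left₀ (norm_nonneg _) h2 2).trans (norm_sq_le_of_star_mul_eq_zero h3)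
    rw [norm_smul, norm_smul, mul_pow, mul_pow, Complex.norm_real, Complex.norm_real,
      Real.norm_eq_abs, Real.norm_eq_abs, sq_abs, sq_abs] at h4
    exact h4
  by_contra hne
  have hpos : 0 < ‖y‖ ^ 2 := by positivity
  have := key (‖e * x‖ ^ 2 / ‖y‖ ^ 2)
  have h5 : ‖e * x‖ ^ 2 / ‖y‖ ^ 2 * ‖y‖ ^ 2 = ‖e * x‖ ^ 2 := div_mul_cancel₀ _ hpos.ne'
  nlinarith [sq_nonneg ‖e * x‖]

theorem apply_isStarProjection_mul (hP : IsPreservingCondExp φ B P) {e : A}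
    (he : IsStarProjection e) (heB : e ∈ B) (x : A) :
    (P (e * x) : A) = e * (P x : A) := by
  have h1 := hP.one_sub_mul_apply_eq_zero he heB x
  have h2 := hP.one_sub_mul_apply_eq_zero he.one_sub (B.sub_mem B.one_mem heB) x
  rw [sub_sub_cancel, sub_mul, one_mul, map_sub] at h2
  rw [sub_mul, one_mul, sub_eq_zero] at h1
  rw [h1, eq_comm, ← sub_eq_zero, ← mul_sub]
  exact h2

/-- Tomiyama's theorem for a subalgebra spanned by projections: `P` is a `B`-module map. -/
theorem apply_mul_of_mem_span (hP : IsPreservingCondExp φ B P) {b : A}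
    (hb : b ∈ Submodule.span ℂ {e : A | IsStarProjection e ∧ e ∈ B}) (x : A) :
    (P (b * x) : A) = b * (P x : A) := by
  induction hb using Submodule.span_induction with
  | mem e he => exact hP.apply_isStarProjection_mul he.1 he.2 x
  | zero => simp
  | add u v _ _ hu hv => rw [add_mul, add_mul, map_add, ← hu, ← hv]; rfl
  | smul c u _ hu => rw [smul_mul_assoc, smul_mul_assoc, map_smul, ← hu]; rfl

/-- A conditional expectation onto a subalgebra spanned by projections is determined by the
faithful functional it preserves: `P x` is the element of `B` with `φ (b * P x) = φ (b * x)` for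
all `b ∈ B`. -/
theorem unique_of_span (hB : ∀ b ∈ B, b ∈ Submodule.span ℂ {e : A | IsStarProjection e ∧ e ∈ B})
    (hφ : ∀ x : A, φ (star x * x) = 0 → x = 0) {Q : A →ₗ[ℂ] B}
    (hP : IsPreservingCondExp φ B P) (hQ : IsPreservingCondExp φ B Q) : P = Q := by
  refine LinearMap.ext fun x => Subtype.ext (sub_eq_zero.mp (hφ _ ?_))
  have hd : star ((P x : A) - Q x) ∈ B := star_mem (B.sub_mem (P x).2 (Q x).2)
  rw [mul_sub, map_sub, ← hP.apply_mul_of_mem_span (hB _ hd), hP.preserving,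
    ← hQ.apply_mul_of_mem_span (hB _ hd), hQ.preserving, sub_self]

end IsPreservingCondExp

end Tomiyama

/-! ### Matrix algebras are spanned by projections -/

section Projections

open Matrix

variable {n : Type*} [Fintype n] [DecidableEq n]

theorem vecMulVec_star_mem_span (v : n → ℂ) :
    vecMulVec v (star v) ∈ Submodule.span ℂ {e : Matrix n n ℂ | IsStarProjection e} := by
  by_cases hv : v = 0
  · simp [hv]
  have hc : star v ⬝ᵥ v ≠ 0 := by
    open scoped ComplexOrder in exact fun h => hv (dotProduct_star_self_eq_zero.mp h)
  have hs : star (star v ⬝ᵥ v) = star v ⬝ᵥ v := (star_dotProduct v v).symm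
  have h : vecMulVec v (star v) = (star v ⬝ᵥ v) • ((star v ⬝ᵥ v)⁻¹ • vecMulVec v (star v)) :=
    (smul_inv_smul₀ hc _).symm
  rw [h]
  refine Submodule.smul_mem _ _ (Submodule.subset_span ⟨?_, ?_⟩)
  · rw [IsIdempotentElem, smul_mul_smul_comm, vecMulVec_mul_vecMulVec, vecMulVec_smul, smul_smul,
      inv_mul_cancel_right₀ hc]
  · rw [IsSelfAdjoint, star_smul, star_inv₀, hs, star_eq_conjTranspose, conjTranspose_vecMulVec,
      star_star]

/-- By polarization, `4 u v* = ∑ z (u + z v) (u + z v)*` over the fourth roots of unity `z`. -/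
theorem span_isStarProjection_eq_top :
    Submodule.span ℂ {e : Matrix n n ℂ | IsStarProjection e} = ⊤ := by
  have pol : ∀ u v : n → ℂ, vecMulVec u (star v) =
      (1 / 4 : ℂ) • (vecMulVec (u + v) (star (u + v)) - vecMulVec (u - v) (star (u - v)) +
        Complex.I • vecMulVec (u + Complex.I • v) (star (u + Complex.I • v)) -
        Complex.I • vecMulVec (u - Complex.I • v) (star (u - Complex.I • v))) := by
    intro u v
    ext i j
    simp [vecMulVec_apply]
    linear_combination ((1 / 2) * u i * (starRingEnd ℂ) (v j)
      - (1 / 2) * v i * (starRingEnd ℂ) (u j)) * Complex.I_sq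
  refine eq_top_iff.mpr fun X _ => ?_
  rw [matrix_eq_sum_single X]
  refine Submodule.sum_mem _ fun i _ => Submodule.sum_mem _ fun j _ => ?_
  have h : single i j (X i j) = X i j • vecMulVec (Pi.single i 1) (star (Pi.single j 1)) := by
    rw [← Pi.single_star, star_one, ← single_eq_single_vecMulVec_single, smul_single]
    simp
  rw [h, pol]
  have m := vecMulVec_star_mem_span (n := n)
  exact Submodule.smul_mem _ _ (Submodule.smul_mem _ _ (Submodule.sub_mem _ (Submodule.add_mem _
    (Submodule.sub_mem _ (m _) (m _)) (Submodule.smul_mem _ _ (m _))) (Submodule.smul_mem _ _ (m _))))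

theorem span_isStarProjection_twoBlock_eq_top (a b : ℕ) :
    Submodule.span ℂ {e : TwoBlock a b | IsStarProjection e} = ⊤ := by
  refine eq_top_iff.mpr fun x _ => ?_
  have h1 : (x.1, (0 : Matrix (Fin b) (Fin b) ℂ)) ∈
      Submodule.span ℂ {e : TwoBlock a b | IsStarProjection e} := by
    have hx : x.1 ∈ Submodule.span ℂ {e : Matrix (Fin a) (Fin a) ℂ | IsStarProjection e} :=
      span_isStarProjection_eq_top (n := Fin a) ▸ Submodule.mem_top
    have := Submodule.mem_map_of_mem (f := LinearMap.inl ℂ _ (Matrix (Fin b) (Fin b) ℂ)) hx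
    rw [Submodule.map_span] at this
    refine Submodule.span_mono ?_ this
    rintro _ ⟨e, he, rfl⟩
    exact ⟨Prod.ext he.1 (mul_zero _), Prod.ext he.2 (star_zero _)⟩
  have h2 : ((0 : Matrix (Fin a) (Fin a) ℂ), x.2) ∈
      Submodule.span ℂ {e : TwoBlock a b | IsStarProjection e} := by
    have hx : x.2 ∈ Submodule.span ℂ {e : Matrix (Fin b) (Fin b) ℂ | IsStarProjection e} :=
      span_isStarProjection_eq_top (n := Fin b) ▸ Submodule.mem_top
    have := Submodule.mem_map_of_mem (f := LinearMap.inr ℂ (Matrix (Fin a) (Fin a) ℂ) _) hx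
    rw [Submodule.map_span] at this
    refine Submodule.span_mono ?_ this
    rintro _ ⟨e, he, rfl⟩
    exact ⟨Prod.ext (mul_zero _) he.1, Prod.ext (star_zero _) he.2⟩
  simpa using Submodule.add_mem _ h1 h2

theorem mem_span_of_mem_range_diagHom (r a b : ℕ) {y : TwoBlock (r * a + b) a}
    (hy : y ∈ (diagHom r a b).range) :
    y ∈ Submodule.span ℂ {e | IsStarProjection e ∧ e ∈ (diagHom r a b).range} := by
  obtain ⟨x, rfl⟩ := hy
  have hx : x ∈ Submodule.span ℂ {e : TwoBlock a b | IsStarProjection e} :=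
    span_isStarProjection_twoBlock_eq_top a b ▸ Submodule.mem_top
  have := Submodule.mem_map_of_mem (f := (diagHom r a b).toAlgHom.toLinearMap) hx
  rw [Submodule.map_span] at this
  refine Submodule.span_mono ?_ this
  rintro _ ⟨e, he, rfl⟩
  exact ⟨he.map (diagHom r a b), e, rfl⟩

end Projections

/-! ### Compressions to the diagonal blocks -/

section Blocks

open Matrix

section Inclusion

variable {m n : Type*} [Fintype n]

theorem norm_one_submatrix_le [Fintype m] [DecidableEq m] [DecidableEq n]
    {f : m → n} (hf : Function.Injective f) :
    ‖(1 : Matrix n n ℂ).submatrix id f‖ ≤ 1 := by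
  have h : ((1 : Matrix n n ℂ).submatrix id f)ᴴ * (1 : Matrix n n ℂ).submatrix id f = 1 := by
    rw [conjTranspose_submatrix, conjTranspose_one,
      ← submatrix_mul _ _ f id f Function.bijective_id, one_mul, submatrix_one _ hf]
  have h1 : ‖(1 : Matrix m m ℂ)‖ ≤ 1 := (IsStarProjection.one _).norm_le
  rw [← h, l2_opNorm_conjTranspose_mul_self] at h1
  nlinarith [norm_nonneg ((1 : Matrix n n ℂ).submatrix id f)]

theorem mul_one_submatrix [DecidableEq n] (C : Matrix n n ℂ) (f : m → n) :
    C * (1 : Matrix n n ℂ).submatrix id f = C.submatrix id f := by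
  ext i j
  simp [mul_apply, one_apply]

theorem norm_submatrix_id_le [Fintype m] [DecidableEq m] [DecidableEq n]
    (C : Matrix n n ℂ) {f : m → n} (hf : Function.Injective f) :
    ‖C.submatrix id f‖ ≤ ‖C‖ := by
  rw [← mul_one_submatrix]
  exact (l2_opNorm_mul _ _).trans
    (mul_le_of_le_one_right (norm_nonneg _) (norm_one_submatrix_le hf))

theorem norm_submatrix_le [Fintype m] [DecidableEq m] [DecidableEq n]
    (C : Matrix n n ℂ) {f : m → n} (hf : Function.Injective f) :
    ‖C.submatrix f f‖ ≤ ‖C‖ := by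
  have h : C.submatrix f f = ((1 : Matrix n n ℂ).submatrix id f)ᴴ * C.submatrix id f := by
    ext i j
    simp [mul_apply, one_apply]
  rw [h]
  refine (l2_opNorm_mul _ _).trans ?_
  rw [l2_opNorm_conjTranspose]
  exact (mul_le_of_le_one_left (norm_nonneg _) (norm_one_submatrix_le hf)).trans
    (norm_submatrix_id_le C hf)

theorem conjTranspose_mul_self_submatrix (C : Matrix n n ℂ) (f : m → n) :
    (Cᴴ * C).submatrix f f = (C.submatrix id f)ᴴ * C.submatrix id f := by
  ext i j
  simp [mul_apply]

end Inclusion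

variable (r a b : ℕ)

/-- The inclusion of the index set of the `k`-th block of size `a`. -/
def blockIncl (k : Fin r) (i : Fin a) : Fin (r * a + b) := blockEquiv r a b (Sum.inl (k, i))

/-- The inclusion of the index set of the last block, of size `b`. -/
def lastIncl (j : Fin b) : Fin (r * a + b) := blockEquiv r a b (Sum.inr j)

variable {r a b}

theorem blockIncl_injective (k : Fin r) : Function.Injective (blockIncl r a b k) := by
  intro i j h
  simpa [blockIncl] using h

theorem lastIncl_injective : Function.Injective (lastIncl r a b) := by
  intro i j h
  simpa [lastIncl] using h

theorem sum_blocks {M : Type*} [AddCommMonoid M] (f : Fin (r * a + b) → M) :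
    ∑ z, f z = ∑ k, ∑ i, f (blockIncl r a b k i) + ∑ j, f (lastIncl r a b j) := by
  rw [← (blockEquiv r a b).sum_comp, Fintype.sum_sum_type, Fintype.sum_prod_type]
  rfl

theorem trace_eq_sum_blocks (C : Matrix (Fin (r * a + b)) (Fin (r * a + b)) ℂ) :
    C.trace = ∑ k, (C.submatrix (blockIncl r a b k) (blockIncl r a b k)).trace +
      (C.submatrix (lastIncl r a b) (lastIncl r a b)).trace :=
  sum_blocks _

theorem diagRepeat_submatrix_blockIncl (X : Matrix (Fin a) (Fin a) ℂ) (Y : Matrix (Fin b) (Fin b) ℂ)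
    (k : Fin r) :
    (diagRepeat r a b X Y).submatrix (blockIncl r a b k) (blockIncl r a b k) = X := by
  ext i j
  simp [diagRepeat, blockIncl]

theorem diagRepeat_submatrix_lastIncl (X : Matrix (Fin a) (Fin a) ℂ)
    (Y : Matrix (Fin b) (Fin b) ℂ) :
    (diagRepeat r a b X Y).submatrix (lastIncl r a b) (lastIncl r a b) = Y := by
  ext i j
  simp [diagRepeat, lastIncl]

/-- A matrix is the sum of its column blocks, each padded by zeros. -/
theorem norm_le_sum_column_blocks (C : Matrix (Fin (r * a + b)) (Fin (r * a + b)) ℂ) :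
    ‖C‖ ≤ ∑ k, ‖C.submatrix id (blockIncl r a b k)‖ + ‖C.submatrix id (lastIncl r a b)‖ := by
  let J (k : Fin r) := (1 : Matrix (Fin (r * a + b)) _ ℂ).submatrix id (blockIncl r a b k)
  let K := (1 : Matrix (Fin (r * a + b)) _ ℂ).submatrix id (lastIncl r a b)
  have hJ : ∀ k, ‖(J k)ᴴ‖ ≤ 1 := fun k => by
    rw [l2_opNorm_conjTranspose]
    exact norm_one_submatrix_le (blockIncl_injective k)
  have hK : ‖Kᴴ‖ ≤ 1 := by
    rw [l2_opNorm_conjTranspose]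
    exact norm_one_submatrix_le lastIncl_injective
  have hC : C = ∑ k, C.submatrix id (blockIncl r a b k) * (J k)ᴴ +
      C.submatrix id (lastIncl r a b) * Kᴴ := by
    ext x y
    have h := sum_blocks (r := r) (a := a) (b := b)
      (fun z => C x z * (1 : Matrix _ _ ℂ)ᴴ z y)
    rw [← mul_apply, conjTranspose_one, mul_one] at h
    rw [h, Matrix.add_apply, Matrix.sum_apply]
    simp [mul_apply, J, K, conjTranspose_submatrix]
    rfl
  conv_lhs => rw [hC]
  refine (norm_add_le _ _).trans (add_le_add ((norm_sum_le _ _).trans ?_) ?_)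
  · exact Finset.sum_le_sum fun k _ => (l2_opNorm_mul _ _).trans
      (mul_le_of_le_one_right (norm_nonneg _) (hJ k))
  · exact (l2_opNorm_mul _ _).trans (mul_le_of_le_one_right (norm_nonneg _) hK)

end Blocks

/-! ### The conditional expectation onto block diagonal matrices -/

section CondExp

open Matrix

variable (r a b : ℕ) (w s : ℝ)

/-- The preimage under `diagHom r a b` of the conditional expectation of `C ⊕ D`: the first
component is the average of `D`, with weight `s`, and of the `r` diagonal blocks of `C` of size `a`,
with weight `w` each; the second component is the last diagonal block of `C`. -/
noncomputable def blockAverage : TwoBlock (r * a + b) a →ₗ[ℂ] TwoBlock a b where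
  toFun x := ((r * w + s)⁻¹ • (w • ∑ k, x.1.submatrix (blockIncl r a b k) (blockIncl r a b k)
    + s • x.2), x.1.submatrix (lastIncl r a b) (lastIncl r a b))
  map_add' x y := by
    refine Prod.ext ?_ rfl
    simp only [Prod.fst_add, Prod.snd_add, submatrix_add, Pi.add_apply, Finset.sum_add_distrib,
      smul_add]
    abel
  map_smul' c x := by
    refine Prod.ext ?_ rfl
    simp only [Prod.smul_fst, Prod.smul_snd, submatrix_smul, Pi.smul_apply, ← Finset.smul_sum,
      smul_comm _ c, smul_add, RingHom.id_apply]

/-- The conditional expectation onto the range of `diagHom r a b` that preserves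
`w Tr ⊕ s Tr`. -/
noncomputable def blockCondExp : TwoBlock (r * a + b) a →ₗ[ℂ] (diagHom r a b).range :=
  (diagHom r a b).rangeRestrict.toAlgHom.toLinearMap ∘ₗ blockAverage r a b w s

theorem coe_blockCondExp (x : TwoBlock (r * a + b) a) :
    (blockCondExp r a b w s x : TwoBlock (r * a + b) a) =
      diagHom r a b (blockAverage r a b w s x) := rfl

variable {r a b w s}

theorem blockAverage_diagHom (h : r * w + s ≠ 0) (x : TwoBlock a b) :
    blockAverage r a b w s (diagHom r a b x) = x := by
  refine Prod.ext ?_ (diagRepeat_submatrix_lastIncl x.1 x.2)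
  change (r * w + s)⁻¹ • (w • ∑ k, (diagRepeat r a b x.1 x.2).submatrix (blockIncl r a b k)
    (blockIncl r a b k) + s • x.1) = x.1
  simp only [diagRepeat_submatrix_blockIncl]
  rw [Finset.sum_const, Finset.card_univ, Fintype.card_fin, ← Nat.cast_smul_eq_nsmul ℝ, smul_smul,
    ← add_smul, smul_smul, mul_comm w, inv_mul_cancel₀ h, one_smul]

theorem norm_blockAverage_le (hw : 0 < w) (hs : 0 < s) (x : TwoBlock (r * a + b) a) :
    ‖blockAverage r a b w s x‖ ≤ ‖x‖ := by
  have hpos : 0 < r * w + s := by positivity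
  refine max_le ?_ ((norm_submatrix_le x.1 lastIncl_injective).trans (norm_fst_le x))
  change ‖(r * w + s)⁻¹ • (w • ∑ k, x.1.submatrix (blockIncl r a b k) (blockIncl r a b k)
    + s • x.2)‖ ≤ ‖x‖
  have h1 : ‖∑ k, x.1.submatrix (blockIncl r a b k) (blockIncl r a b k)‖ ≤ r * ‖x‖ := by
    refine (norm_sum_le _ _).trans ((Finset.sum_le_card_nsmul _ _ ‖x‖ fun k _ => ?_).trans ?_)
    · exact (norm_submatrix_le x.1 (blockIncl_injective k)).trans (norm_fst_le x)
    · simp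
  rw [norm_smul, norm_inv, Real.norm_of_nonneg hpos.le, inv_mul_le_iff₀ hpos]
  refine (norm_add_le _ _).trans ?_
  rw [norm_smul, norm_smul, Real.norm_of_nonneg hw.le, Real.norm_of_nonneg hs.le]
  nlinarith [mul_le_mul_of_nonneg_left h1 hw.le,
    mul_le_mul_of_nonneg_left (norm_snd_le x) hs.le]

theorem isPreservingCondExp_blockCondExp (hw : 0 < w) (hs : 0 < s)
    {φ : TwoBlock (r * a + b) a →ₗ[ℂ] ℂ} (hφ : ∀ x, φ x = w * x.1.trace + s * x.2.trace) :
    IsPreservingCondExp φ (diagHom r a b).range (blockCondExp r a b w s) where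
  apply_coe := by
    rintro ⟨_, x, rfl⟩
    refine Subtype.ext ?_
    exact congrArg (diagHom r a b) (blockAverage_diagHom (by positivity) x)
  norm_le x := (NonUnitalStarAlgHom.norm_apply_le (diagHom r a b) _).trans
    (norm_blockAverage_le hw hs x)
  preserving x := by
    have hpos : ((r * w + s : ℝ) : ℂ) ≠ 0 := by exact_mod_cast (by positivity : r * w + s ≠ 0)
    rw [coe_blockCondExp, hφ, hφ]
    set y := blockAverage r a b w s x with hy
    change w * (diagRepeat r a b y.1 y.2).trace + s * y.1.trace = _
    rw [trace_eq_sum_blocks, trace_eq_sum_blocks x.1]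
    simp only [diagRepeat_submatrix_blockIncl, diagRepeat_submatrix_lastIncl]
    have h1 : ((r * w + s : ℝ) : ℂ) * y.1.trace =
        w * ∑ k, (x.1.submatrix (blockIncl r a b k) (blockIncl r a b k)).trace
          + s * x.2.trace := by
      simp only [hy, blockAverage, LinearMap.coe_mk, AddHom.coe_mk, trace_smul, trace_add,
        trace_sum, Complex.real_smul, Complex.ofReal_inv]
      rw [mul_inv_cancel_left₀ hpos]
    have h2 : y.2 = x.1.submatrix (lastIncl r a b) (lastIncl r a b) := rfl
    rw [← h2]
    push_cast at h1
    simp only [Finset.sum_const, Finset.card_univ, Fintype.card_fin, nsmul_eq_mul]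
    linear_combination h1

theorem eq_zero_of_trace_star_mul_self {m n : ℕ} (hw : 0 < w) (hs : 0 < s) (x : TwoBlock m n)
    (h : w * (star x * x).1.trace + s * (star x * x).2.trace = 0) : x = 0 := by
  open scoped ComplexOrder in
  have p1 : 0 ≤ (x.1ᴴ * x.1).trace := (posSemidef_conjTranspose_mul_self x.1).trace_nonneg
  have p2 : 0 ≤ (x.2ᴴ * x.2).trace := (posSemidef_conjTranspose_mul_self x.2).trace_nonneg
  have hw' : (0 : ℂ) < w := by exact_mod_cast hw
  have hs' : (0 : ℂ) < s := by exact_mod_cast hs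
  change w * (x.1ᴴ * x.1).trace + s * (x.2ᴴ * x.2).trace = 0 at h
  rw [add_eq_zero_iff_of_nonneg (mul_nonneg hw'.le p1) (mul_nonneg hs'.le p2)] at h
  refine Prod.ext ?_ ?_
  · exact trace_conjTranspose_mul_self_eq_zero_iff.mp ((mul_eq_zero.mp h.1).resolve_left hw'.ne')
  · exact trace_conjTranspose_mul_self_eq_zero_iff.mp ((mul_eq_zero.mp h.2).resolve_left hs'.ne')

/-! ### The lower bound for the Frobenius–Rieffel norm -/

section LowerBound

open scoped MatrixOrder ComplexOrder

/-- The weighted sum that defines the first component of `blockAverage` dominates each of its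
terms, because all of them are positive. -/
theorem smul_norm_sq_le_blockAverage (hw : 0 < w) (hs : 0 < s) (x : TwoBlock (r * a + b) a) :
    (∀ k, w * ‖x.1.submatrix id (blockIncl r a b k)‖ ^ 2 ≤
      (r * w + s) * ‖blockAverage r a b w s (star x * x)‖) ∧
    s * ‖x.2‖ ^ 2 ≤ (r * w + s) * ‖blockAverage r a b w s (star x * x)‖ := by
  have hpos : 0 < r * w + s := by positivity
  let G (k : Fin r) := (x.1.submatrix id (blockIncl r a b k))ᴴ * x.1.submatrix id (blockIncl r a b k)
  have hG : ∀ k, 0 ≤ w • G k := fun k =>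
    smul_nonneg hw.le (posSemidef_conjTranspose_mul_self _).nonneg
  have hD : 0 ≤ s • (x.2ᴴ * x.2) :=
    smul_nonneg hs.le (posSemidef_conjTranspose_mul_self _).nonneg
  have hS : ‖∑ k, w • G k + s • (x.2ᴴ * x.2)‖ ≤
      (r * w + s) * ‖blockAverage r a b w s (star x * x)‖ := by
    have h1 : (blockAverage r a b w s (star x * x)).1 =
        (r * w + s)⁻¹ • (∑ k, w • G k + s • (x.2ᴴ * x.2)) := by
      simp only [G, ← conjTranspose_mul_self_submatrix, ← Finset.smul_sum]
      rfl
    rw [← inv_mul_le_iff₀ hpos, ← Real.norm_of_nonneg hpos.le, ← norm_inv, ← norm_smul, ← h1]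
    exact norm_fst_le _
  refine ⟨fun k => le_trans ?_ hS, le_trans ?_ hS⟩
  · rw [sq, ← l2_opNorm_conjTranspose_mul_self, ← Real.norm_of_nonneg hw.le, ← norm_smul,
      Real.norm_of_nonneg hw.le]
    exact CStarAlgebra.norm_le_norm_of_nonneg_of_le (hG k)
      (le_add_of_le_of_nonneg (Finset.single_le_sum (fun k _ => hG k) (Finset.mem_univ k)) hD)
  · rw [sq, ← l2_opNorm_conjTranspose_mul_self, ← Real.norm_of_nonneg hs.le, ← norm_smul,
      Real.norm_of_nonneg hs.le]
    exact CStarAlgebra.norm_le_norm_of_nonneg_of_le hD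
      (le_add_of_nonneg_left (Finset.sum_nonneg fun k _ => hG k))

theorem norm_blockAverage_le_norm_diagHom (y : TwoBlock a b) : ‖y‖ ≤ ‖diagHom r a b y‖ := by
  refine max_le (norm_snd_le (diagHom r a b y)) ?_
  have h : y.2 = (diagHom r a b y).1.submatrix (lastIncl r a b) (lastIncl r a b) :=
    (diagRepeat_submatrix_lastIncl y.1 y.2).symm
  rw [h]
  exact (norm_submatrix_le _ lastIncl_injective).trans (norm_fst_le _)

theorem norm_sq_le_blockCondExp (hs : 0 < s) (hsw : s ≤ w) (x : TwoBlock (r * a + b) a) :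
    ‖x‖ ^ 2 ≤ ((r : ℝ) + 1) ^ 2 * ((r * w + s) / s) *
      ‖(blockCondExp r a b w s (star x * x) : TwoBlock (r * a + b) a)‖ := by
  have hw : 0 < w := hs.trans_le hsw
  set N := ‖blockAverage r a b w s (star x * x)‖ with hN
  have hNP : N ≤ ‖(blockCondExp r a b w s (star x * x) : TwoBlock (r * a + b) a)‖ :=
    norm_blockAverage_le_norm_diagHom _
  have hN0 : 0 ≤ N := norm_nonneg _
  obtain ⟨hk, hD⟩ := smul_norm_sq_le_blockAverage hw hs x
  set R := (r * w + s) / s with hR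
  have hR1 : 1 ≤ R := by
    rw [hR, one_le_div hs]
    have : 0 ≤ r * w := by positivity
    linarith
  have hT : 0 ≤ R * N := by positivity
  have hRs : (r * w + s) * N = s * (R * N) := by
    rw [hR]
    field_simp
  have hcol : ∀ k, ‖x.1.submatrix id (blockIncl r a b k)‖ ≤ √(R * N) := fun k => by
    refine Real.le_sqrt_of_sq_le (le_of_mul_le_mul_left ?_ hs)
    rw [← hRs]
    exact (mul_le_mul_of_nonneg_right hsw (sq_nonneg _)).trans (hk k)
  have hlast : ‖x.1.submatrix id (lastIncl r a b)‖ ≤ √(R * N) := by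
    refine Real.le_sqrt_of_sq_le (le_trans ?_ (le_mul_of_one_le_left hN0 hR1))
    rw [sq, ← l2_opNorm_conjTranspose_mul_self, ← conjTranspose_mul_self_submatrix]
    exact norm_snd_le (blockAverage r a b w s (star x * x))
  have h1 : ‖x.1‖ ≤ ((r : ℝ) + 1) * √(R * N) := by
    refine (norm_le_sum_column_blocks x.1).trans ?_
    have := Finset.sum_le_card_nsmul Finset.univ _ _ fun k _ => hcol k
    simp only [Finset.card_univ, Fintype.card_fin, nsmul_eq_mul] at this
    linarith
  have h2 : ‖x.2‖ ≤ ((r : ℝ) + 1) * √(R * N) := by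
    refine (Real.le_sqrt_of_sq_le (le_of_mul_le_mul_left (hD.trans_eq hRs) hs)).trans ?_
    exact le_mul_of_one_le_left (Real.sqrt_nonneg _) (by linarith [r.cast_nonneg (α := ℝ)])
  calc ‖x‖ ^ 2 ≤ (((r : ℝ) + 1) * √(R * N)) ^ 2 :=
        pow_le_pow_left₀ (norm_nonneg _) (max_le h1 h2) 2
    _ = ((r : ℝ) + 1) ^ 2 * R * N := by rw [mul_pow, Real.sq_sqrt hT, mul_assoc]
    _ ≤ _ := mul_le_mul_of_nonneg_left hNP (by positivity)

end LowerBound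

end CondExp

/-! ### The Effros–Shen tracial states -/

/-- The weights of the tracial state are `|θ q_{N-1} - p_{N-1}|` and `|θ q_N - p_N|`. -/
theorem traceState_apply {θ : ℝ} (hθ : Irrational θ) (n : ℕ) (x : Alg θ (n + 1)) :
    traceState θ n x = approxError θ (n + 1) * x.1.trace + approxError θ (n + 2) * x.2.trace := by
  have hq1 : (cfDen θ (n + 1) : ℂ) ≠ 0 := by exact_mod_cast (cfDen_succ_pos hθ n).ne'
  have hq2 : (cfDen θ (n + 2) : ℂ) ≠ 0 := by exact_mod_cast (cfDen_succ_pos hθ (n + 1)).ne'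
  have h1 : (weight θ n : ℂ) / cfDen θ (n + 2) = approxError θ (n + 1) := by
    rw [weight_eq]
    push_cast
    rw [mul_div_cancel_left₀ _ hq2]
  have h2 : (1 - (weight θ n : ℂ)) / cfDen θ (n + 1) = approxError θ (n + 2) := by
    have h := congrArg (fun z : ℝ => (z : ℂ)) (cfDen_mul_approxError_add θ (n + 1))
    push_cast at h
    rw [div_eq_iff hq1, weight_eq, ← h]
    push_cast
    ring
  rw [← h1, ← h2]
  rfl

/-- For every faithful trace `w Tr ⊕ s Tr` with `s ≤ w` there is exactly one conditional expectation
onto the range of `diagHom r a b`, and its Frobenius–Rieffel norm is equivalent to the norm. -/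
theorem existsUnique_condExp_and_norm_le {r a b : ℕ} {w s : ℝ} (hs : 0 < s) (hsw : s ≤ w)
    {φ : TwoBlock (r * a + b) a →ₗ[ℂ] ℂ} (hφ : ∀ x, φ x = w * x.1.trace + s * x.2.trace) :
    (∃! P : TwoBlock (r * a + b) a →ₗ[ℂ] (diagHom r a b).range,
      IsPreservingCondExp φ (diagHom r a b).range P) ∧
    ∀ P : TwoBlock (r * a + b) a →ₗ[ℂ] (diagHom r a b).range,
      IsPreservingCondExp φ (diagHom r a b).range P → ∀ x : TwoBlock (r * a + b) a,
        ‖x‖ ^ 2 ≤ ((r : ℝ) + 1) ^ 2 * ((r * w + s) / s) * frobeniusRieffelNorm P x ^ 2 ∧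
        frobeniusRieffelNorm P x ≤ ‖x‖ := by
  have hw : 0 < w := hs.trans_le hsw
  have hE := isPreservingCondExp_blockCondExp hw hs hφ
  have huniq : ∀ P : TwoBlock (r * a + b) a →ₗ[ℂ] (diagHom r a b).range,
      IsPreservingCondExp φ (diagHom r a b).range P → P = blockCondExp r a b w s := fun P hP =>
    hP.unique_of_span (fun _ h => mem_span_of_mem_range_diagHom r a b h)
      (fun x hx => eq_zero_of_trace_star_mul_self hw hs x (by rw [← hφ, hx])) hE
  refine ⟨⟨_, hE, huniq⟩, fun P hP x => ⟨?_, ?_⟩⟩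
  · rw [frobeniusRieffelNorm, Real.sq_sqrt (norm_nonneg _), huniq P hP]
    exact norm_sq_le_blockCondExp hs hsw x
  · refine Real.sqrt_le_iff.mpr ⟨norm_nonneg _, (hP.norm_le _).trans_eq ?_⟩
    rw [CStarRing.norm_star_mul_self, sq]

end EffrosShen

/-- The positive integer `N` of the result is `n + 1`, with `n : ℕ` arbitrary. -/
theorem theoreme (n : ℕ) :
    -- the Frobenius–Rieffel norm is well defined, and the norm inequalities hold
    (∀ θ ∈ EffrosShen.irrationals,
      0 < EffrosShen.ratio θ n ∧
      (∃! P : EffrosShen.Alg θ (n + 1) →ₗ[ℂ] EffrosShen.Sub θ n,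
        EffrosShen.IsPreservingCondExp (EffrosShen.traceState θ n) (EffrosShen.Sub θ n) P) ∧
      ∀ P : EffrosShen.Alg θ (n + 1) →ₗ[ℂ] EffrosShen.Sub θ n,
        EffrosShen.IsPreservingCondExp (EffrosShen.traceState θ n) (EffrosShen.Sub θ n) P →
        ∀ a : EffrosShen.Alg θ (n + 1),
          Real.sqrt (EffrosShen.ratio θ n) * ‖a‖ ≤ EffrosShen.frobeniusRieffelNorm P a ∧
          EffrosShen.frobeniusRieffelNorm P a ≤ ‖a‖) ∧
    -- continuity in the irrational parameter
    (∀ θ ∈ EffrosShen.irrationals, ∀ u : ℕ → ℝ, (∀ k, u k ∈ EffrosShen.irrationals) →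
      Tendsto u atTop (𝓝 θ) →
      Tendsto (fun k => EffrosShen.ratio (u k) n) atTop (𝓝 (EffrosShen.ratio θ n))) ∧
    ContinuousOn (fun θ => Real.sqrt (EffrosShen.ratio θ n)) EffrosShen.irrationals := by
  open EffrosShen in
  refine ⟨fun θ hθ => ?_, fun θ hθ u hu hlim => ?_, (continuousOn_ratio n).sqrt⟩
  · obtain ⟨h0, -, hirr⟩ := hθ
    have hδ := approxError_pos h0 hirr
    obtain ⟨hex, hnorm⟩ := existsUnique_condExp_and_norm_le (hδ (n + 2))
      (approxError_succ_le h0 hirr (n + 1)) (traceState_apply hirr n)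
    refine ⟨ratio_pos h0 hirr n, hex, fun P hP x => ⟨?_, (hnorm P hP x).2⟩⟩
    have h := (hnorm P hP x).1
    have hr : (1 : ℝ) ≤ cfTerm θ (n + 1) := by exact_mod_cast one_le_cfTerm_succ hirr n
    -- the total weight `r |θ q_{N-1} - p_{N-1}| + |θ q_N - p_N|` is `|θ q_{N-2} - p_{N-2}|`
    rw [show cfTerm θ (n + 1) * approxError θ (n + 1) + approxError θ (n + 2) = approxError θ n by
      rw [approxError_add_two]; ring] at h
    have hF : 0 ≤ frobeniusRieffelNorm P x := Real.sqrt_nonneg _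
    have h0' := hδ n
    have h2' := hδ (n + 2)
    refine (sq_le_sq₀ (by positivity) hF).mp ?_
    rw [mul_pow, Real.sq_sqrt (ratio_pos h0 hirr n).le, ratio_eq, div_mul_eq_mul_div,
      div_le_iff₀ (by positivity)]
    calc approxError θ (n + 2) * ‖x‖ ^ 2
        ≤ approxError θ (n + 2) * (((cfTerm θ (n + 1) : ℝ) + 1) ^ 2 *
          (approxError θ n / approxError θ (n + 2)) * frobeniusRieffelNorm P x ^ 2) :=
          mul_le_mul_of_nonneg_left h h2'.le
      _ = 1 * (approxError θ n * ((cfTerm θ (n + 1) : ℝ) + 1) ^ 2 *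
          frobeniusRieffelNorm P x ^ 2) := by
        field_simp
      _ ≤ cfTerm θ (n + 1) * (approxError θ n * ((cfTerm θ (n + 1) : ℝ) + 1) ^ 2 *
          frobeniusRieffelNorm P x ^ 2) := mul_le_mul_of_nonneg_right hr (by positivity)
      _ = _ := by ring
  · have hu' : Tendsto u atTop (𝓝[irrationals] θ) :=
      tendsto_nhdsWithin_iff.mpr ⟨hlim, Eventually.of_forall hu⟩
    exact (continuousOn_ratio n θ hθ).tendsto.comp hu'
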